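/- Let $H$ be a complex Hilbert space and let $A,B$ be bounded self-adjoint operators on $H$. A state on $H$ is a positive trace-class operator $\rho$ with $\operatorname{Tr}\rho=1$; for a unit vector $x\in H$ the rank-one projection $P_x=\langle\,\cdot\,,x\rangle x$ is called a pure state. For a state $\rho$ and a bounded self-adjoint operator $A$ put $$\Delta_\rho(A)=\operatorname{Tr}(\rho A^2)-\bigl(\operatorname{Tr}(\rho A)\bigr)^2,\qquad \Delta_x(A)=\Delta_{P_x}(A)=\langle A^2x,x\rangle-\langle Ax,x\rangle^2 .$$ Then the following three conditions are equivalent: (i) $\Delta_x(A)\le\Delta_x(B)$ for all unit vectors $x\in H$ (that is, in all pure states); (ii) $\Delta_\rho(A)\le\Delta_\rho(B)$ for all states $\rho$ on $H$; (iii) there is a function $f\colon\sigma(B)\to\mathbb{R}$ on the spectrum of $B$ with $|f(s)-f(t)|\le|s-t|$ for all $s,t\in\sigma(B)$ such that $A=f(B)$, where $f(B)$ is given by the continuous functional calculus. -/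

import Mathlib

noncomputable section

namespace VarianceOrder

variable {H : Type*} [NormedAddCommGroup H] [InnerProductSpace ℂ H] [CompleteSpace H]

variable (H) in
/-- The underlying set of an orthonormal (Hilbert) basis of `H`. -/
def basisSet : Set H := (exists_hilbertBasis ℂ H).choose

variable (H) in
/-- An orthonormal (Hilbert) basis of `H`, used to write down traces. For trace-class operators
the trace is the same in every orthonormal basis. -/
def onb : HilbertBasis (basisSet H) ℂ H := (exists_hilbertBasis ℂ H).choose_spec.choose

/-- `T` is trace class: `∑ ⟨|T| eᵢ, eᵢ⟩ < ∞`, where `|T| = √(T⋆ T)`. -/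
def IsTraceClass (T : H →L[ℂ] H) : Prop :=
  Summable fun i => (inner ℂ (onb H i) (CFC.abs T (onb H i))).re

/-- The trace `Tr T = ∑ ⟨T eᵢ, eᵢ⟩` of a trace-class operator. -/
def trace (T : H →L[ℂ] H) : ℂ := ∑' i, inner ℂ (onb H i) (T (onb H i))

/-- (Mixed) states, or density operators: positive trace-class operators of trace `1`. -/
structure IsState (ρ : H →L[ℂ] H) : Prop where
  isPositive : ρ.IsPositive
  isTraceClass : IsTraceClass ρ
  trace_eq_one : trace ρ = 1

/-- The expectation value `𝔼_ρ(A) = Tr(ρ A)`; this trace is real for a state `ρ` and a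
self-adjoint `A`. -/
def expectation (ρ A : H →L[ℂ] H) : ℝ := (trace (ρ * A)).re

/-- The variance `Δ_ρ(A) = 𝔼_ρ(A²) - 𝔼_ρ(A)²`. -/
def variance (ρ A : H →L[ℂ] H) : ℝ := expectation ρ (A ^ 2) - expectation ρ A ^ 2

/-- The operator `P_x = ⟨·, x⟩ x`; for a unit vector `x`, the rank-one projection that
represents the pure state `x`. -/
def pureState (x : H) : H →L[ℂ] H := InnerProductSpace.rankOne ℂ x x

theorem trace_pureState_mul (x : H) (A : H →L[ℂ] H) :
    trace (pureState x * A) = inner ℂ x (A x) := by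
  have h := (onb H).tsum_inner_mul_inner (ContinuousLinearMap.adjoint A x) x
  rw [ContinuousLinearMap.adjoint_inner_left] at h
  rw [← h]
  unfold trace pureState
  refine tsum_congr fun i => ?_
  simp [ContinuousLinearMap.adjoint_inner_left]

/-- The variance in a pure state is `⟨A² x, x⟩ - ⟨A x, x⟩²`. -/
theorem variance_pureState (x : H) (A : H →L[ℂ] H) :
    variance (pureState x) A = (inner ℂ x ((A ^ 2) x)).re - (inner ℂ x (A x)).re ^ 2 := by
  simp only [variance, expectation, trace_pureState_mul]

/-- Pure states are states. -/
theorem isState_pureState {x : H} (hx : ‖x‖ = 1) : IsState (pureState x) := by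
  have hpos : (pureState x).IsPositive := InnerProductSpace.isPositive_rankOne_self x
  have htr : trace (pureState x) = 1 := by
    have h := trace_pureState_mul x (1 : H →L[ℂ] H)
    rw [mul_one] at h
    rw [h, one_apply_eq_self, inner_self_eq_norm_sq_to_K, hx]
    simp
  refine ⟨hpos, ?_, htr⟩
  have hs : Summable fun i => inner ℂ (onb H i) (pureState x (onb H i)) := by
    by_contra h
    rw [trace, tsum_eq_zero_of_not_summable h] at htr
    exact zero_ne_one htr
  have habs : CFC.abs (pureState x) = pureState x :=
    CFC.abs_of_nonneg _ ((ContinuousLinearMap.nonneg_iff_isPositive _).2 hpos)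
  unfold IsTraceClass
  rw [habs]
  exact Complex.reCLM.summable hs

end VarianceOrder

end

/-!
For a unit vector `x`, the variance of `A` in the state `x` is the minimum over real `c` of
`‖A x - c x‖²`. So domination of variances in pure states says that every vector which is nearly an
eigenvector of `B` is nearly an eigenvector of `A`, with the same error
(`exists_norm_sub_smul_le`).

From pure states to a Lipschitz function. If unit vectors `x`, `y` are approximate eigenvectors for
the eigenvalues `s`, `t` of `B` and `a`, `b` of `A`, adjust the phase of `y` so that
`Re ⟨x, y⟩ = 0` and test the domination on `x + y`: up to the errors, the two variances are governed
by `(a - b)²` and `(s - t)²`, whence `|a - b| ≤ |s - t| + O(error)`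
(`abs_sub_le_of_approx_eigenvectors`). Applied with `s = t` this shows that the approximate
eigenvalue of `A` at `s ∈ σ(B)` converges to some `f s`, and applied with general `s`, `t` that `f`
is `1`-Lipschitz (`exists_lipschitz_approx_eigenvalue`). To see that `A = f(B)`, cut a vector into
`N` pieces `φ k (B) x` with a partition of unity on `σ(B)` of mesh `O(1 / N)`. On each piece
`A - f(B)` has norm `O(1 / N)` (`norm_sub_cfcHom_le_of_localized`), and the norms of the pieces add
up to at most `√N ‖x‖` by Cauchy-Schwarz (`sq_sum_norm_cfcHom_le`). So
`‖A x - f(B) x‖ = O(1 / √N)`. It is essential here that the error is linear in the mesh. No spectral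
projections are needed, nor is it needed that `A` and `B` commute.

From a Lipschitz function to mixed states. For a state `ρ` one has
`Tr(ρ T) = ∑ ⟨√ρ eⱼ, T √ρ eⱼ⟩` (`IsState.trace_mul`), so `T ↦ Tr(ρ T)` is positive, and
`h ↦ Tr(ρ h(B))` is a positive normalized functional `φ` on `C(σ(B))`. Applying `φ` in each of the
two variables to `(s - t)² - (f s - f t)² ≥ 0` gives twice the desired inequality
(`variance_le_of_abs_sub_le`).
-/

noncomputable section

namespace VarianceOrder

/-! ### Variance under a positive functional on continuous functions -/

/-- The variance inequality for a positive normalized functional `φ`: with `φ` represented by a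
measure it would read `∬ (f s - f t)² ≤ ∬ (g s - g t)²`. The double integral is replaced by two
applications of `φ`, so that no measure is needed. -/
theorem variance_le_of_abs_sub_le {X : Type*} [TopologicalSpace X] (φ : C(X, ℝ) →ₗ[ℝ] ℝ)
    (hpos : ∀ h : C(X, ℝ), 0 ≤ h → 0 ≤ φ h) (hone : φ 1 = 1) (f g : C(X, ℝ))
    (hfg : ∀ s t, |f s - f t| ≤ |g s - g t|) :
    φ (f ^ 2) - φ f ^ 2 ≤ φ (g ^ 2) - φ g ^ 2 := by
  -- Positivity of `φ` on `s ↦ (g s - g t)² - (f s - f t)²`, for each fixed `t`.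
  have hfirst (t : X) :
      0 ≤ φ (g ^ 2) - φ (f ^ 2) - 2 * φ g * g t + g t ^ 2 + 2 * φ f * f t - f t ^ 2 := by
    have h := hpos (g ^ 2 - (2 * g t) • g + (g t ^ 2) • 1 - f ^ 2 + (2 * f t) • f - (f t ^ 2) • 1)
      (ContinuousMap.le_def.2 fun s => by
        have := sq_le_sq.2 (hfg s t)
        simp only [ContinuousMap.zero_apply, ContinuousMap.add_apply, ContinuousMap.sub_apply,
          ContinuousMap.smul_apply, ContinuousMap.pow_apply, ContinuousMap.one_apply, smul_eq_mul]
        linarith)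
    simp only [map_add, map_sub, map_smul, hone, smul_eq_mul] at h
    linarith
  -- The expression in `hfirst` is a continuous function of `t`, to which `φ` applies once more.
  have h := hpos ((φ (g ^ 2) - φ (f ^ 2)) • 1 - (2 * φ g) • g + g ^ 2 + (2 * φ f) • f - f ^ 2)
    (ContinuousMap.le_def.2 fun t => by
      simp only [ContinuousMap.zero_apply, ContinuousMap.add_apply, ContinuousMap.sub_apply,
        ContinuousMap.smul_apply, ContinuousMap.pow_apply, ContinuousMap.one_apply, smul_eq_mul]
      linarith [hfirst t])
  simp only [map_add, map_sub, map_smul, hone, smul_eq_mul] at h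
  linarith

/-! ### Expectation values in mixed states -/

section States

variable {H : Type*} [NormedAddCommGroup H] [InnerProductSpace ℂ H]

theorem summable_inner_apply {ι : Type*} {v : ι → H} (hv : Summable fun i => ‖v i‖ ^ 2)
    (T : H →L[ℂ] H) : Summable fun i => inner ℂ (v i) (T (v i)) := by
  refine Summable.of_norm_bounded (hv.mul_left ‖T‖) fun i => ?_
  calc ‖inner ℂ (v i) (T (v i))‖ ≤ ‖v i‖ * (‖T‖ * ‖v i‖) :=
        (norm_inner_le_norm _ _).trans (by gcongr; exact T.le_opNorm _)
    _ = ‖T‖ * ‖v i‖ ^ 2 := by ring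

variable [CompleteSpace H]

/-- Parseval's identity. -/
theorem hasSum_sq_norm_inner_onb (x : H) :
    HasSum (fun i => ‖inner ℂ (onb H i) x‖ ^ 2) (‖x‖ ^ 2) := by
  have h := Complex.hasSum_re ((onb H).hasSum_inner_mul_inner x x)
  convert h using 1
  · funext i
    rw [← inner_conj_symm x, Complex.conj_mul']
    norm_cast
  · rw [inner_self_eq_norm_sq_to_K]
    norm_cast

theorem IsState.nonneg {ρ : H →L[ℂ] H} (hρ : IsState ρ) : 0 ≤ ρ :=
  (ContinuousLinearMap.nonneg_iff_isPositive _).2 hρ.isPositive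

theorem adjoint_sqrt (ρ : H →L[ℂ] H) :
    ContinuousLinearMap.adjoint (CFC.sqrt ρ) = CFC.sqrt ρ :=
  (CFC.sqrt_nonneg ρ).isSelfAdjoint.adjoint_eq

theorem IsState.inner_apply_right {ρ : H →L[ℂ] H} (hρ : IsState ρ) (x y : H) :
    inner ℂ x (ρ y) = inner ℂ (CFC.sqrt ρ x) (CFC.sqrt ρ y) := by
  conv_lhs => rw [← CFC.sqrt_mul_sqrt_self ρ hρ.nonneg]
  rw [mul_apply_eq_comp, ← ContinuousLinearMap.adjoint_inner_left, adjoint_sqrt]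

/-- The square root of a state is a Hilbert-Schmidt operator. -/
theorem IsState.summable_sq_norm_sqrt {ρ : H →L[ℂ] H} (hρ : IsState ρ) :
    Summable fun i => ‖CFC.sqrt ρ (onb H i)‖ ^ 2 := by
  have h := hρ.isTraceClass
  unfold IsTraceClass at h
  rw [CFC.abs_of_nonneg _ hρ.nonneg] at h
  refine h.congr fun i => ?_
  rw [hρ.inner_apply_right, inner_self_eq_norm_sq_to_K]
  norm_cast

/-- The cyclic form `Tr(ρ T) = Tr(√ρ T √ρ)` of the trace, in which the series converges absolutely
and has nonnegative terms when `T` is positive. -/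
theorem IsState.trace_mul {ρ : H →L[ℂ] H} (hρ : IsState ρ) (T : H →L[ℂ] H) :
    trace (ρ * T) = ∑' j, inner ℂ (CFC.sqrt ρ (onb H j)) (T (CFC.sqrt ρ (onb H j))) := by
  set K := CFC.sqrt ρ with hK
  have hadj : ContinuousLinearMap.adjoint K = K := adjoint_sqrt ρ
  -- `⟨eᵢ, ρ T eᵢ⟩ = ⟨√ρ eᵢ, √ρ T eᵢ⟩` is expanded in the basis and the double sum interchanged.
  -- It converges absolutely since `a` and `b` are the matrices of Hilbert-Schmidt operators.
  let a : basisSet H → basisSet H → ℂ := fun i j => inner ℂ (K (onb H i)) (onb H j)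
  let b : basisSet H → basisSet H → ℂ := fun i j => inner ℂ (onb H j) (K (T (onb H i)))
  have hsum := hρ.summable_sq_norm_sqrt
  have ha : Summable fun p : basisSet H × basisSet H => ‖a p.1 p.2‖ ^ 2 := by
    have hrow (i) : HasSum (fun j => ‖a i j‖ ^ 2) (‖K (onb H i)‖ ^ 2) := by
      simpa only [a, norm_inner_symm] using hasSum_sq_norm_inner_onb (K (onb H i))
    refine (summable_prod_of_nonneg fun _ => by positivity).2 ⟨fun i => (hrow i).summable, ?_⟩
    exact hsum.congr fun i => (hrow i).tsum_eq.symm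
  have hb : Summable fun p : basisSet H × basisSet H => ‖b p.1 p.2‖ ^ 2 := by
    have hcol (j) : HasSum (fun i => ‖b i j‖ ^ 2)
        (‖ContinuousLinearMap.adjoint T (K (onb H j))‖ ^ 2) := by
      convert hasSum_sq_norm_inner_onb (ContinuousLinearMap.adjoint T (K (onb H j))) using 3
      rw [ContinuousLinearMap.adjoint_inner_right, norm_inner_symm, ← hadj,
        ContinuousLinearMap.adjoint_inner_left, hadj]
    rw [← (Equiv.prodComm _ _).summable_iff]
    refine (summable_prod_of_nonneg fun _ => sq_nonneg _).2 ⟨fun j => (hcol j).summable, ?_⟩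
    refine Summable.of_nonneg_of_le (fun _ => tsum_nonneg fun _ => sq_nonneg _) (fun j => ?_)
      (hsum.mul_left (‖ContinuousLinearMap.adjoint T‖ ^ 2))
    refine (hcol j).tsum_eq.le.trans ?_
    rw [← mul_pow]
    gcongr
    exact ContinuousLinearMap.le_opNorm _ _
  have hab : Summable (Function.uncurry fun i j => a i j * b i j) := by
    refine Summable.of_norm_bounded (ha.add hb) fun p => ?_
    simp only [Function.uncurry, norm_mul]
    nlinarith [sq_nonneg (‖a p.1 p.2‖ - ‖b p.1 p.2‖), sq_nonneg ‖a p.1 p.2‖,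
      sq_nonneg ‖b p.1 p.2‖]
  calc trace (ρ * T) = ∑' i, ∑' j, a i j * b i j := by
        refine tsum_congr fun i => ?_
        rw [mul_apply_eq_comp, hρ.inner_apply_right]
        exact ((onb H).tsum_inner_mul_inner _ _).symm
    _ = ∑' j, ∑' i, a i j * b i j := hab.tsum_comm.symm
    _ = _ := by
        refine tsum_congr fun j => ?_
        rw [← ContinuousLinearMap.adjoint_inner_left, ← (onb H).tsum_inner_mul_inner]
        refine tsum_congr fun i => ?_
        rw [mul_comm, ContinuousLinearMap.adjoint_inner_left]
        congr 1
        · simp only [b]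
          rw [← ContinuousLinearMap.adjoint_inner_left, hadj]
        · simp only [a]
          rw [← ContinuousLinearMap.adjoint_inner_right, hadj]

theorem IsState.hasSum_expectation {ρ : H →L[ℂ] H} (hρ : IsState ρ) (T : H →L[ℂ] H) :
    HasSum (fun j => (inner ℂ (CFC.sqrt ρ (onb H j)) (T (CFC.sqrt ρ (onb H j)))).re)
      (expectation ρ T) := by
  rw [expectation, hρ.trace_mul]
  exact Complex.hasSum_re (summable_inner_apply hρ.summable_sq_norm_sqrt T).hasSum

theorem IsState.expectation_nonneg {ρ T : H →L[ℂ] H} (hρ : IsState ρ) (hT : 0 ≤ T) :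
    0 ≤ expectation ρ T :=
  (hρ.hasSum_expectation T).nonneg fun _ =>
    ((ContinuousLinearMap.nonneg_iff_isPositive _).1 hT).re_inner_nonneg_right _

/-- The expectation value in the state `ρ` as a real-linear functional on operators. -/
def IsState.expectationLinear {ρ : H →L[ℂ] H} (hρ : IsState ρ) : (H →L[ℂ] H) →ₗ[ℝ] ℝ where
  toFun := expectation ρ
  map_add' S T := by
    refine (hρ.hasSum_expectation (S + T)).unique ?_
    convert (hρ.hasSum_expectation S).add (hρ.hasSum_expectation T) using 2 with j
    simp
  map_smul' c T := by
    have h : HasSum (fun j => c * (inner ℂ (CFC.sqrt ρ (onb H j)) (T (CFC.sqrt ρ (onb H j)))).re)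
        (c * expectation ρ T) := (hρ.hasSum_expectation T).mul_left c
    refine (hρ.hasSum_expectation (c • T)).unique ?_
    change HasSum _ (c * expectation ρ T)
    convert h using 2 with j
    rw [smul_apply, RCLike.real_smul_eq_coe_smul (K := ℂ), inner_smul_right]
    exact Complex.re_ofReal_mul _ _

/-- Passing to a `1`-Lipschitz function of an observable does not increase its variance. -/
theorem IsState.variance_cfcHom_le {ρ B : H →L[ℂ] H} (hρ : IsState ρ) (hB : IsSelfAdjoint B)
    {f : spectrum ℝ B → ℝ} (hf : LipschitzWith 1 f) :
    variance ρ (cfcHom hB ⟨f, hf.continuous⟩) ≤ variance ρ B := by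
  let φ : C(spectrum ℝ B, ℝ) →ₗ[ℝ] ℝ :=
    hρ.expectationLinear ∘ₗ (cfcHom (R := ℝ) hB).toAlgHom.toLinearMap
  have hφ (h : C(spectrum ℝ B, ℝ)) : φ h = expectation ρ (cfcHom hB h) := rfl
  have key := variance_le_of_abs_sub_le φ
    (fun h hh => hρ.expectation_nonneg ((cfcHom_nonneg_iff hB).2 hh))
    (by rw [hφ, map_one, expectation, mul_one, hρ.trace_eq_one, Complex.one_re])
    ⟨f, hf.continuous⟩ ((ContinuousMap.id ℝ).restrict (spectrum ℝ B))
    (fun s t => by simpa [Real.dist_eq, Subtype.dist_eq] using hf.dist_le_mul s t)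
  simp only [hφ, map_pow, cfcHom_id hB] at key
  exact key

end States

variable {H : Type*} [NormedAddCommGroup H] [InnerProductSpace ℂ H]

/-! ### Approximate eigenvectors under variance domination -/

theorem norm_apply_smul_sub_smul (T : H →L[ℂ] H) (k c : ℂ) (x : H) :
    ‖T (k • x) - c • k • x‖ = ‖k‖ * ‖T x - c • x‖ := by
  rw [map_smul, smul_comm c, ← smul_sub, norm_smul]

theorem norm_inv_norm_smul {x : H} (hx : x ≠ 0) : ‖((‖x‖⁻¹ : ℝ) : ℂ) • x‖ = 1 := by
  rw [norm_smul, Complex.norm_real, norm_inv, norm_norm, inv_mul_cancel₀ (norm_ne_zero_iff.2 hx)]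

theorem norm_apply_normalize_sub_smul_le {T : H →L[ℂ] H} {c : ℂ} {x : H} {d : ℝ} (hx : x ≠ 0)
    (h : ‖T x - c • x‖ ≤ d * ‖x‖) :
    ‖T (((‖x‖⁻¹ : ℝ) : ℂ) • x) - c • ((‖x‖⁻¹ : ℝ) : ℂ) • x‖ ≤ d := by
  rw [norm_apply_smul_sub_smul, Complex.norm_real, norm_inv, norm_norm, inv_mul_eq_div,
    div_le_iff₀ (norm_pos_iff.2 hx)]
  exact h

/-- Approximate eigenvalues of `A` are at most as far apart as those of `B`, up to the errors. When
`Re ⟨x, y⟩ = 0`, the vectors `x + y` and `x - y` both have norm `√2` and their inner product is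
purely imaginary. Up to the errors, `(B - (s + t) / 2) (x + y) = (s - t) / 2 • (x - y)`, while the
real part of the inner product of `(A - c) (x + y)` with `x - y` is `a - b` for every real `c`. -/
theorem abs_sub_le_of_re_inner_eq_zero {A B : H →L[ℂ] H}
    (hAB : ∀ (z : H) (m : ℝ), ∃ c : ℝ, ‖A z - (c : ℂ) • z‖ ≤ ‖B z - (m : ℂ) • z‖)
    {x y : H} (hx : ‖x‖ = 1) (hy : ‖y‖ = 1) (hxy : (inner ℂ x y).re = 0) {s t a b d e : ℝ}
    (hBx : ‖B x - (s : ℂ) • x‖ ≤ d) (hAx : ‖A x - (a : ℂ) • x‖ ≤ d)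
    (hBy : ‖B y - (t : ℂ) • y‖ ≤ e) (hAy : ‖A y - (b : ℂ) • y‖ ≤ e) :
    |a - b| ≤ |s - t| + 3 * (d + e) := by
  obtain ⟨c, hc⟩ := hAB (x + y) ((s + t) / 2)
  have hyx : (inner ℂ y x).re = 0 := by rw [← hxy]; exact inner_re_symm (𝕜 := ℂ) y x
  have hxx : inner ℂ x x = (1 : ℂ) := by rw [inner_self_eq_norm_sq_to_K, hx]; simp
  have hyy : inner ℂ y y = (1 : ℂ) := by rw [inner_self_eq_norm_sq_to_K, hy]; simp
  have hw2 : ‖x - y‖ ^ 2 = 2 := by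
    rw [norm_sub_sq (𝕜 := ℂ), hx, hy]
    simp only [RCLike.re_to_complex, hxy]
    norm_num
  have hw : ‖x - y‖ = √2 := by rw [← hw2, Real.sqrt_sq (norm_nonneg _)]
  have hB : ‖B (x + y) - (((s + t) / 2 : ℝ) : ℂ) • (x + y)‖ ≤ |s - t| / 2 * √2 + (d + e) := by
    have : B (x + y) - (((s + t) / 2 : ℝ) : ℂ) • (x + y) =
        (((s - t) / 2 : ℝ) : ℂ) • (x - y) + ((B x - (s : ℂ) • x) + (B y - (t : ℂ) • y)) := by
      rw [map_add]; push_cast; module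
    rw [this]
    refine (norm_add_le _ _).trans (add_le_add ?_ ((norm_add_le _ _).trans (add_le_add hBx hBy)))
    rw [norm_smul, hw, Complex.norm_real, Real.norm_eq_abs, abs_div, abs_two]
  have hA : a - b = (inner ℂ (x - y) (A (x + y) - (c : ℂ) • (x + y))).re -
      (inner ℂ (x - y) ((A x - (a : ℂ) • x) + (A y - (b : ℂ) • y))).re := by
    have : A (x + y) - (c : ℂ) • (x + y) - ((A x - (a : ℂ) • x) + (A y - (b : ℂ) • y)) =
        ((a - c : ℝ) : ℂ) • x + ((b - c : ℝ) : ℂ) • y := by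
      rw [map_add]; push_cast; module
    rw [← Complex.sub_re, ← inner_sub_right, this, inner_add_right, inner_smul_right,
      inner_smul_right, inner_sub_left, inner_sub_left, hxx, hyy, Complex.add_re,
      Complex.re_ofReal_mul, Complex.re_ofReal_mul, Complex.sub_re, Complex.sub_re, hxy, hyx,
      Complex.one_re]
    ring
  have h1 : |(inner ℂ (x - y) (A (x + y) - (c : ℂ) • (x + y))).re| ≤
      √2 * (|s - t| / 2 * √2 + (d + e)) := by
    refine (Complex.abs_re_le_norm _).trans ((norm_inner_le_norm _ _).trans ?_)
    rw [hw]
    gcongr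
    exact hc.trans hB
  have h2 : |(inner ℂ (x - y) ((A x - (a : ℂ) • x) + (A y - (b : ℂ) • y))).re| ≤
      √2 * (d + e) := by
    refine (Complex.abs_re_le_norm _).trans ((norm_inner_le_norm _ _).trans ?_)
    rw [hw]
    gcongr
    exact (norm_add_le _ _).trans (add_le_add hAx hAy)
  have hde : 0 ≤ d + e := add_nonneg ((norm_nonneg _).trans hBx) ((norm_nonneg _).trans hBy)
  have h22 : √2 * √2 = 2 := Real.mul_self_sqrt (by norm_num)
  have h32 : √2 ≤ 3 / 2 := by rw [Real.sqrt_le_left (by norm_num)]; norm_num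
  calc |a - b| ≤ √2 * (|s - t| / 2 * √2 + (d + e)) + √2 * (d + e) := by
        rw [hA]; exact (abs_sub _ _).trans (add_le_add h1 h2)
    _ = |s - t| / 2 * (√2 * √2) + 2 * √2 * (d + e) := by ring
    _ ≤ |s - t| / 2 * 2 + 2 * (3 / 2) * (d + e) := by rw [h22]; gcongr
    _ = |s - t| + 3 * (d + e) := by ring

theorem exists_norm_eq_one_re_mul_eq_zero (p : ℂ) : ∃ ω : ℂ, ‖ω‖ = 1 ∧ (ω * p).re = 0 := by
  by_cases hp : p = 0
  · exact ⟨1, norm_one, by simp [hp]⟩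
  · have hp' : (‖p‖ : ℂ) ≠ 0 := by exact_mod_cast norm_ne_zero_iff.2 hp
    refine ⟨Complex.I * (starRingEnd ℂ p / ‖p‖), ?_, ?_⟩
    · simp [hp]
    · rw [mul_assoc, div_mul_eq_mul_div, Complex.conj_mul', sq, mul_div_assoc, div_self hp', mul_one]
      simp

/-- Approximate eigenvalues of `A` are at most as far apart as those of `B`, up to the errors; this
is homogeneous in `x` and `y`, and the phase of `y` plays no role. -/
theorem abs_sub_le_of_approx_eigenvectors {A B : H →L[ℂ] H}
    (hAB : ∀ (z : H) (m : ℝ), ∃ c : ℝ, ‖A z - (c : ℂ) • z‖ ≤ ‖B z - (m : ℂ) • z‖)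
    {x y : H} (hx : x ≠ 0) (hy : y ≠ 0) {s t a b d e : ℝ}
    (hBx : ‖B x - (s : ℂ) • x‖ ≤ d * ‖x‖) (hAx : ‖A x - (a : ℂ) • x‖ ≤ d * ‖x‖)
    (hBy : ‖B y - (t : ℂ) • y‖ ≤ e * ‖y‖) (hAy : ‖A y - (b : ℂ) • y‖ ≤ e * ‖y‖) :
    |a - b| ≤ |s - t| + 3 * (d + e) := by
  set u := ((‖x‖⁻¹ : ℝ) : ℂ) • x
  set v := ((‖y‖⁻¹ : ℝ) : ℂ) • y
  obtain ⟨ω, hω, hre⟩ := exists_norm_eq_one_re_mul_eq_zero (inner ℂ u v)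
  refine abs_sub_le_of_re_inner_eq_zero hAB (x := u) (y := ω • v) (norm_inv_norm_smul hx) ?_ ?_
    (norm_apply_normalize_sub_smul_le hx hBx) (norm_apply_normalize_sub_smul_le hx hAx) ?_ ?_
  · rw [norm_smul, hω, one_mul]; exact norm_inv_norm_smul hy
  · rw [inner_smul_right]; exact hre
  · rw [norm_apply_smul_sub_smul, hω, one_mul]; exact norm_apply_normalize_sub_smul_le hy hBy
  · rw [norm_apply_smul_sub_smul, hω, one_mul]; exact norm_apply_normalize_sub_smul_le hy hAy

variable [CompleteSpace H]

/-- For a unit vector `x`, the quantity `‖A x - m x‖²` is smallest at `m = ⟨x, A x⟩`, where it equals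
the variance. -/
theorem sq_norm_apply_sub_smul {A : H →L[ℂ] H} (hA : IsSelfAdjoint A) {x : H} (hx : ‖x‖ = 1)
    (m : ℝ) :
    ‖A x - (m : ℂ) • x‖ ^ 2 =
      variance (pureState x) A + ((inner ℂ x (A x)).re - m) ^ 2 := by
  have h1 : (inner ℂ x ((A ^ 2) x)).re = ‖A x‖ ^ 2 := by
    rw [sq A, mul_apply_eq_comp, ← ContinuousLinearMap.adjoint_inner_left, hA.adjoint_eq,
      inner_self_eq_norm_sq_to_K]
    norm_cast
  have h2 : (inner ℂ (A x) x).re = (inner ℂ x (A x)).re := inner_re_symm (𝕜 := ℂ) _ _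
  rw [variance_pureState, h1, norm_sub_sq (𝕜 := ℂ), inner_smul_right, norm_smul, hx,
    Complex.norm_real, RCLike.re_to_complex, Complex.re_ofReal_mul, h2, mul_one,
    Real.norm_eq_abs, sq_abs]
  ring

/-- Domination of variances in pure states, in the form in which it is used: approximate
eigenvectors of `B` are approximate eigenvectors of `A`, with the same error. -/
theorem exists_norm_sub_smul_le {A B : H →L[ℂ] H} (hA : IsSelfAdjoint A) (hB : IsSelfAdjoint B)
    (h : ∀ x : H, ‖x‖ = 1 → variance (pureState x) A ≤ variance (pureState x) B)
    (z : H) (m : ℝ) : ∃ c : ℝ, ‖A z - (c : ℂ) • z‖ ≤ ‖B z - (m : ℂ) • z‖ := by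
  by_cases hz : z = 0
  · exact ⟨0, by simp [hz]⟩
  · set x := ((‖z‖⁻¹ : ℝ) : ℂ) • z
    have hx : ‖x‖ = 1 := norm_inv_norm_smul hz
    have hzx : z = (‖z‖ : ℂ) • x := by
      have : (‖z‖ : ℂ) ≠ 0 := by exact_mod_cast norm_ne_zero_iff.2 hz
      simp only [x, smul_smul, Complex.ofReal_inv, mul_inv_cancel₀ this, one_smul]
    have hscale (T : H →L[ℂ] H) (c : ℂ) : ‖T z - c • z‖ = ‖z‖ * ‖T x - c • x‖ := by
      have := norm_apply_smul_sub_smul T ‖z‖ c x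
      rwa [← hzx, Complex.norm_real, norm_norm] at this
    refine ⟨(inner ℂ x (A x)).re, ?_⟩
    rw [hscale, hscale]
    refine mul_le_mul_of_nonneg_left (le_of_sq_le_sq ?_ (norm_nonneg _)) (norm_nonneg _)
    rw [sq_norm_apply_sub_smul hA hx, sq_norm_apply_sub_smul hB hx, sub_self]
    nlinarith [h x hx, sq_nonneg ((inner ℂ x (B x)).re - m)]

/-! ### Norm estimates for the functional calculus -/

variable {B : H →L[ℂ] H} (hB : IsSelfAdjoint B)

theorem sq_norm_cfcHom_apply (g : C(spectrum ℝ B, ℝ)) (x : H) :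
    ‖cfcHom hB g x‖ ^ 2 = (inner ℂ x (cfcHom hB (g ^ 2) x)).re := by
  have hg : IsSelfAdjoint (cfcHom hB g) := (IsSelfAdjoint.all g).map (cfcHom hB)
  rw [map_pow, sq (cfcHom hB g), mul_apply_eq_comp, ← ContinuousLinearMap.adjoint_inner_left,
    hg.adjoint_eq, inner_self_eq_norm_sq_to_K]
  norm_cast

theorem re_inner_cfcHom_mono {g h : C(spectrum ℝ B, ℝ)} (hgh : g ≤ h) (x : H) :
    (inner ℂ x (cfcHom hB g x)).re ≤ (inner ℂ x (cfcHom hB h x)).re := by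
  have := ((ContinuousLinearMap.nonneg_iff_isPositive _).1
    ((cfcHom_nonneg_iff hB).2 (sub_nonneg.2 hgh))).re_inner_nonneg_right x
  rw [map_sub, sub_apply, inner_sub_right] at this
  simpa using this

theorem norm_cfcHom_apply_le {g h : C(spectrum ℝ B, ℝ)} (hgh : ∀ s, |g s| ≤ |h s|) (x : H) :
    ‖cfcHom hB g x‖ ≤ ‖cfcHom hB h x‖ := by
  refine le_of_sq_le_sq ?_ (norm_nonneg _)
  rw [sq_norm_cfcHom_apply, sq_norm_cfcHom_apply]
  exact re_inner_cfcHom_mono hB (ContinuousMap.le_def.2 fun s => sq_le_sq.2 (hgh s)) x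

/-- On a vector localized by `φ` to a part of the spectrum where `g` is within `d` of `c`, the
operator `g(B)` acts as the scalar `c`, up to a relative error `d`. -/
theorem norm_cfcHom_sub_smul_le (g φ : C(spectrum ℝ B, ℝ)) {c d : ℝ} (hd : 0 ≤ d)
    (h : ∀ s, φ s ≠ 0 → |g s - c| ≤ d) (x : H) :
    ‖cfcHom hB g (cfcHom hB φ x) - (c : ℂ) • cfcHom hB φ x‖ ≤ d * ‖cfcHom hB φ x‖ := by
  have h1 : cfcHom hB g (cfcHom hB φ x) - (c : ℂ) • cfcHom hB φ x =
      cfcHom hB (g * φ - c • φ) x := by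
    rw [map_sub, map_mul, map_smul, sub_apply, smul_apply, mul_apply_eq_comp,
      RCLike.real_smul_eq_coe_smul (K := ℂ)]
    rfl
  have h2 : d * ‖cfcHom hB φ x‖ = ‖cfcHom hB (d • φ) x‖ := by
    rw [map_smul, smul_apply, norm_smul, Real.norm_of_nonneg hd]
  rw [h1, h2]
  refine norm_cfcHom_apply_le hB (fun s => ?_) x
  simp only [ContinuousMap.sub_apply, ContinuousMap.mul_apply, ContinuousMap.smul_apply,
    smul_eq_mul, ← sub_mul, abs_mul, abs_of_nonneg hd]
  by_cases hs : φ s = 0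
  · simp [hs]
  · gcongr
    exact h s hs

theorem norm_sub_smul_cfcHom_le (φ : C(spectrum ℝ B, ℝ)) {c d : ℝ} (hd : 0 ≤ d)
    (h : ∀ s, φ s ≠ 0 → |(s : ℝ) - c| ≤ d) (x : H) :
    ‖B (cfcHom hB φ x) - (c : ℂ) • cfcHom hB φ x‖ ≤ d * ‖cfcHom hB φ x‖ := by
  have := norm_cfcHom_sub_smul_le hB ((ContinuousMap.id ℝ).restrict (spectrum ℝ B)) φ hd h x
  rwa [cfcHom_id hB] at this

theorem exists_approx_eigenvector {B : H →L[ℂ] H} (hB : IsSelfAdjoint B) (s : spectrum ℝ B)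
    {d : ℝ} (hd : 0 < d) :
    ∃ x : H, x ≠ 0 ∧ ‖B x - ((s : ℝ) : ℂ) • x‖ ≤ d * ‖x‖ := by
  let φ : C(spectrum ℝ B, ℝ) := ⟨fun t => max 0 (d - |(t : ℝ) - s|), by fun_prop⟩
  have hφ : cfcHom hB φ ≠ 0 := by
    intro h
    rw [← map_zero (cfcHom (R := ℝ) hB)] at h
    have := DFunLike.congr_fun (cfcHom_injective hB h) s
    simp only [φ, ContinuousMap.coe_mk, sub_self, abs_zero, sub_zero,
      ContinuousMap.zero_apply] at this
    rw [max_eq_right hd.le] at this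
    exact hd.ne' this
  obtain ⟨v, hv⟩ : ∃ v, cfcHom hB φ v ≠ 0 := by
    by_contra! h
    exact hφ (ContinuousLinearMap.ext h)
  refine ⟨_, hv, norm_sub_smul_cfcHom_le hB φ hd.le (fun t ht => ?_) v⟩
  by_contra! hlt
  exact ht (max_eq_left (by linarith))

/-! ### The Lipschitz function -/

/-- The value `f s` is the limit of the eigenvalues `a` of `A` for approximate eigenvectors of `B`
at `s`, with an error bound that is linear in the quality `d` of the approximation. -/
theorem exists_lipschitz_approx_eigenvalue {A B : H →L[ℂ] H} (hB : IsSelfAdjoint B)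
    (hAB : ∀ (z : H) (m : ℝ), ∃ c : ℝ, ‖A z - (c : ℂ) • z‖ ≤ ‖B z - (m : ℂ) • z‖) :
    ∃ f : spectrum ℝ B → ℝ, LipschitzWith 1 f ∧
      ∀ (s : spectrum ℝ B) (x : H) (a d : ℝ), x ≠ 0 → ‖B x - ((s : ℝ) : ℂ) • x‖ ≤ d * ‖x‖ →
        ‖A x - (a : ℂ) • x‖ ≤ d * ‖x‖ → |a - f s| ≤ 3 * d := by
  -- The intervals `[a - 3 d, a + 3 d]` meet pairwise, so the supremum of their left endpoints lies
  -- in all of them.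
  let S (s : spectrum ℝ B) : Set ℝ := {r | ∃ (x : H) (a d : ℝ), x ≠ 0 ∧
    ‖B x - ((s : ℝ) : ℂ) • x‖ ≤ d * ‖x‖ ∧ ‖A x - (a : ℂ) • x‖ ≤ d * ‖x‖ ∧ r = a - 3 * d}
  have hS (s : spectrum ℝ B) (x : H) (a d : ℝ) (hx : x ≠ 0)
      (hBx : ‖B x - ((s : ℝ) : ℂ) • x‖ ≤ d * ‖x‖) (hAx : ‖A x - (a : ℂ) • x‖ ≤ d * ‖x‖) :
      a + 3 * d ∈ upperBounds (S s) := by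
    rintro _ ⟨y, b, e, hy, hBy, hAy, rfl⟩
    have := abs_sub_le_of_approx_eigenvectors hAB hx hy hBx hAx hBy hAy
    rw [sub_self, abs_zero, zero_add] at this
    linarith [neg_le_of_abs_le this]
  have hf (s : spectrum ℝ B) (x : H) (a d : ℝ) (hx : x ≠ 0)
      (hBx : ‖B x - ((s : ℝ) : ℂ) • x‖ ≤ d * ‖x‖) (hAx : ‖A x - (a : ℂ) • x‖ ≤ d * ‖x‖) :
      |a - sSup (S s)| ≤ 3 * d := by
    have hmem : a - 3 * d ∈ S s := ⟨x, a, d, hx, hBx, hAx, rfl⟩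
    have hub := hS s x a d hx hBx hAx
    rw [abs_sub_le_iff]
    constructor
    · linarith [le_csSup ⟨_, hub⟩ hmem]
    · linarith [csSup_le ⟨_, hmem⟩ hub]
  refine ⟨fun s => sSup (S s), LipschitzWith.of_dist_le_mul fun s t => ?_, hf⟩
  rw [NNReal.coe_one, one_mul, Real.dist_eq, Subtype.dist_eq, Real.dist_eq]
  refine le_of_forall_pos_le_add fun ε hε => ?_
  obtain ⟨x, hx, hBx⟩ := exists_approx_eigenvector hB s (d := ε / 12) (by positivity)
  obtain ⟨y, hy, hBy⟩ := exists_approx_eigenvector hB t (d := ε / 12) (by positivity)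
  obtain ⟨a, ha⟩ := hAB x s
  obtain ⟨b, hb⟩ := hAB y t
  have h1 := hf s x a _ hx hBx (ha.trans hBx)
  have h2 := hf t y b _ hy hBy (hb.trans hBy)
  have h3 := abs_sub_le_of_approx_eigenvectors hAB hx hy hBx (ha.trans hBx) hBy (hb.trans hBy)
  rw [abs_le] at h1 h2 h3 ⊢
  constructor <;> linarith

/-- `A` and `f(B)` nearly agree on a vector whose spectral support with respect to `B` has
diameter at most `d`. -/
theorem norm_sub_cfcHom_le_of_localized {A : H →L[ℂ] H}
    (hAB : ∀ (z : H) (m : ℝ), ∃ c : ℝ, ‖A z - (c : ℂ) • z‖ ≤ ‖B z - (m : ℂ) • z‖)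
    {f : spectrum ℝ B → ℝ} (hf : LipschitzWith 1 f)
    (hfA : ∀ (s : spectrum ℝ B) (x : H) (a d : ℝ), x ≠ 0 →
      ‖B x - ((s : ℝ) : ℂ) • x‖ ≤ d * ‖x‖ → ‖A x - (a : ℂ) • x‖ ≤ d * ‖x‖ → |a - f s| ≤ 3 * d)
    (φ : C(spectrum ℝ B, ℝ)) {d : ℝ} (hd : 0 ≤ d)
    (hφ : ∀ s t, φ s ≠ 0 → φ t ≠ 0 → |(s : ℝ) - t| ≤ d) (x : H) :
    ‖A (cfcHom hB φ x) - cfcHom hB ⟨f, hf.continuous⟩ (cfcHom hB φ x)‖ ≤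
      5 * d * ‖cfcHom hB φ x‖ := by
  set v := cfcHom hB φ x with hv
  by_cases hv0 : v = 0
  · simp [hv0]
  obtain ⟨t, ht⟩ : ∃ t, φ t ≠ 0 := by
    by_contra! h
    have : φ = 0 := ContinuousMap.ext h
    exact hv0 (by rw [hv, this, map_zero, zero_apply])
  have hBv : ‖B v - ((t : ℝ) : ℂ) • v‖ ≤ d * ‖v‖ :=
    norm_sub_smul_cfcHom_le hB φ hd (fun s hs => hφ s t hs ht) x
  have hfv : ‖cfcHom hB ⟨f, hf.continuous⟩ v - (f t : ℂ) • v‖ ≤ d * ‖v‖ := by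
    refine norm_cfcHom_sub_smul_le hB _ φ hd (fun s hs => ?_) x
    refine le_trans ?_ (hφ s t hs ht)
    simpa [Real.dist_eq, Subtype.dist_eq] using hf.dist_le_mul s t
  obtain ⟨a, ha⟩ := hAB v t
  have haf := hfA t v a d hv0 hBv (ha.trans hBv)
  have hdec : A v - cfcHom hB ⟨f, hf.continuous⟩ v = (A v - (a : ℂ) • v) +
      ((a - f t : ℝ) : ℂ) • v - (cfcHom hB ⟨f, hf.continuous⟩ v - (f t : ℂ) • v) := by
    push_cast; module
  calc ‖A v - cfcHom hB ⟨f, hf.continuous⟩ v‖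
      ≤ d * ‖v‖ + 3 * d * ‖v‖ + d * ‖v‖ := by
        rw [hdec]
        refine (norm_sub_le _ _).trans (add_le_add ((norm_add_le _ _).trans
          (add_le_add (ha.trans hBv) ?_)) hfv)
        rw [norm_smul, Complex.norm_real, Real.norm_eq_abs]
        gcongr
    _ = 5 * d * ‖v‖ := by ring

/-- The pieces of `x` under a partition of unity are almost orthogonal: `∑ ‖φ k (B) x‖² ≤ ‖x‖²`
because `(φ k)² ≤ φ k`, and Cauchy-Schwarz gives the bound on the sum of the norms. -/
theorem sq_sum_norm_cfcHom_le {N : ℕ} {φ : ℕ → C(spectrum ℝ B, ℝ)} (h0 : ∀ k, 0 ≤ φ k)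
    (hsum : ∑ k ∈ Finset.range N, φ k = 1) (x : H) :
    (∑ k ∈ Finset.range N, ‖cfcHom hB (φ k) x‖) ^ 2 ≤ N * ‖x‖ ^ 2 := by
  refine sq_sum_le_card_mul_sum_sq.trans ?_
  rw [Finset.card_range]
  gcongr
  have h1 (k) (hk : k ∈ Finset.range N) : φ k ≤ 1 :=
    hsum ▸ Finset.single_le_sum (f := φ) (fun i _ => h0 i) hk
  calc ∑ k ∈ Finset.range N, ‖cfcHom hB (φ k) x‖ ^ 2
      ≤ ∑ k ∈ Finset.range N, (inner ℂ x (cfcHom hB (φ k) x)).re := by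
        refine Finset.sum_le_sum fun k hk => ?_
        rw [sq_norm_cfcHom_apply]
        refine re_inner_cfcHom_mono hB (ContinuousMap.le_def.2 fun s => ?_) x
        exact pow_le_of_le_one (h0 k s) (h1 k hk s) two_ne_zero
    _ = (inner ℂ x (cfcHom hB (∑ k ∈ Finset.range N, φ k) x)).re := by
        rw [map_sum, sum_apply, inner_sum, Complex.re_sum]
    _ = ‖x‖ ^ 2 := by
        rw [hsum, map_one, one_apply_eq_self, inner_self_eq_norm_sq_to_K]
        norm_cast

/-! ### Partitions of unity and the identification of `A` with `f(B)` -/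

/-- The continuous function that is `0` on `(-∞, 0]`, `1` on `[1, ∞)` and linear between. -/
def ramp (u : ℝ) : ℝ := max 0 (min 1 u)

theorem continuous_ramp : Continuous ramp := by unfold ramp; fun_prop

theorem monotone_ramp : Monotone ramp := fun _ _ h => max_le_max le_rfl (min_le_min le_rfl h)

theorem ramp_of_nonpos {u : ℝ} (hu : u ≤ 0) : ramp u = 0 :=
  max_eq_left ((min_le_right _ _).trans hu)

theorem ramp_of_one_le {u : ℝ} (hu : 1 ≤ u) : ramp u = 1 := by
  rw [ramp, min_eq_left hu, max_eq_right zero_le_one]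

/-- A partition of unity into `N` functions on a subset of `[-R, R]` with supports of diameter at
most `6 * R / N`. -/
theorem exists_partition_of_unity {X : Set ℝ} {R : ℝ} (hR : 0 < R) (hX : ∀ s ∈ X, |s| ≤ R) {N : ℕ}
    (hN : 3 ≤ N) : ∃ φ : ℕ → C(X, ℝ), (∀ k, 0 ≤ φ k) ∧ ∑ k ∈ Finset.range N, φ k = 1 ∧
      ∀ k s t, φ k s ≠ 0 → φ k t ≠ 0 → |(s : ℝ) - t| ≤ 6 * R / N := by
  have hN0 : (0 : ℝ) < N := by positivity
  have hN3 : (3 : ℝ) ≤ N := by exact_mod_cast hN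
  -- `u` maps `[-R, R]` into `[1, N]`; the `k`-th function is the tent `ramp (u - k) - ramp (u - k - 1)`
  -- supported where `k ≤ u ≤ k + 2`, and the sum of the tents telescopes.
  let u (s : X) : ℝ := (s + 2 * R) * (N / (3 * R))
  let ψ (k : ℕ) : C(X, ℝ) := ⟨fun s => ramp (u s - k), continuous_ramp.comp (by fun_prop)⟩
  have hψ (k : ℕ) (s : X) : ψ k s = ramp (u s - k) := rfl
  have hsupp (k : ℕ) (s : X) (hs : (ψ k - ψ (k + 1)) s ≠ 0) : 0 ≤ u s - k ∧ u s - k ≤ 2 := by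
    rw [ContinuousMap.sub_apply, hψ, hψ, Nat.cast_succ] at hs
    constructor <;> by_contra! h
    · exact hs (by rw [ramp_of_nonpos h.le, ramp_of_nonpos (by linarith), sub_self])
    · exact hs (by rw [ramp_of_one_le (by linarith), ramp_of_one_le (by linarith), sub_self])
  refine ⟨fun k => ψ k - ψ (k + 1), fun k => ContinuousMap.le_def.2 fun s => ?_, ?_,
    fun k s t hs ht => ?_⟩
  · rw [ContinuousMap.sub_apply, hψ, hψ, Nat.cast_succ]
    exact sub_nonneg.2 (monotone_ramp (by linarith))
  · rw [Finset.sum_range_sub']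
    ext s
    have hs := abs_le.1 (hX s s.2)
    have h1 : 1 ≤ u s := by
      calc (1 : ℝ) ≤ R * (N / (3 * R)) := by
            rw [mul_div_assoc', le_div_iff₀ (by positivity)]; nlinarith
        _ ≤ u s := by simp only [u]; gcongr; linarith
    have h2 : u s ≤ N := by
      calc u s ≤ (3 * R) * (N / (3 * R)) := by simp only [u]; gcongr; linarith
        _ = N := by field_simp
    rw [ContinuousMap.sub_apply, hψ, hψ, ramp_of_nonpos (sub_nonpos.2 h2), Nat.cast_zero,
      sub_zero, sub_zero, ramp_of_one_le h1, ContinuousMap.one_apply]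
  · have h1 := hsupp k s hs
    have h2 := hsupp k t ht
    have hst : (s : ℝ) - t = (u s - u t) * (3 * R / N) := by simp only [u]; field_simp; ring
    rw [hst, abs_mul, abs_of_pos (by positivity : 0 < 3 * R / N)]
    calc |u s - u t| * (3 * R / N) ≤ 2 * (3 * R / N) := by
          gcongr
          rw [abs_le]
          constructor <;> linarith
      _ = 6 * R / N := by ring

/-- If approximate eigenvectors of `B` are approximate eigenvectors of `A` with the same error, then
`A` is a `1`-Lipschitz function of `B`. -/
theorem exists_lipschitz_eq_cfcHom {A B : H →L[ℂ] H} (hB : IsSelfAdjoint B)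
    (hAB : ∀ (z : H) (m : ℝ), ∃ c : ℝ, ‖A z - (c : ℂ) • z‖ ≤ ‖B z - (m : ℂ) • z‖) :
    ∃ (f : spectrum ℝ B → ℝ) (hf : LipschitzWith 1 f), A = cfcHom hB ⟨f, hf.continuous⟩ := by
  obtain ⟨f, hf, hfA⟩ := exists_lipschitz_approx_eigenvalue hB hAB
  refine ⟨f, hf, ContinuousLinearMap.ext fun x => ?_⟩
  obtain ⟨R, hR, hX⟩ : ∃ R : ℝ, 0 < R ∧ ∀ s ∈ spectrum ℝ B, |s| ≤ R :=
    (ContinuousFunctionalCalculus.isCompact_spectrum (R := ℝ) (p := IsSelfAdjoint) B).isBounded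
      |>.exists_pos_norm_le
  set D := A - cfcHom hB ⟨f, hf.continuous⟩ with hD
  have hbound (N : ℕ) (hN : 3 ≤ N) : N * ‖D x‖ ^ 2 ≤ (30 * R * ‖x‖) ^ 2 := by
    obtain ⟨φ, h0, hsum, hdiam⟩ := exists_partition_of_unity hR hX hN
    have hN0 : (0 : ℝ) < N := by positivity
    have hDx : ‖D x‖ ≤ 5 * (6 * R / N) * ∑ k ∈ Finset.range N, ‖cfcHom hB (φ k) x‖ := by
      have hx : x = ∑ k ∈ Finset.range N, cfcHom hB (φ k) x := by
        rw [← sum_apply, ← map_sum, hsum, map_one, one_apply_eq_self]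
      conv_lhs => rw [hx, map_sum]
      rw [Finset.mul_sum]
      exact norm_sum_le_of_le _ fun k _ =>
        norm_sub_cfcHom_le_of_localized hB hAB hf hfA (φ k) (by positivity) (hdiam k) x
    calc N * ‖D x‖ ^ 2
        ≤ N * (5 * (6 * R / N) * ∑ k ∈ Finset.range N, ‖cfcHom hB (φ k) x‖) ^ 2 := by gcongr
      _ ≤ N * ((5 * (6 * R / N)) ^ 2 * (N * ‖x‖ ^ 2)) := by
          rw [mul_pow]
          gcongr
          exact sq_sum_norm_cfcHom_le hB h0 hsum x
      _ = (30 * R * ‖x‖) ^ 2 := by field_simp; ring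
  have hzero : D x = 0 := by
    by_contra h
    have hpos : 0 < ‖D x‖ ^ 2 := by have := norm_pos_iff.2 h; positivity
    obtain ⟨N, hN⟩ := exists_nat_gt ((30 * R * ‖x‖) ^ 2 / ‖D x‖ ^ 2)
    rw [div_lt_iff₀ hpos] at hN
    have h1 := hbound (max 3 N) (le_max_left _ _)
    have h2 : (N : ℝ) ≤ (max 3 N : ℕ) := by exact_mod_cast le_max_right _ _
    nlinarith
  rwa [hD, sub_apply, sub_eq_zero] at hzero

end VarianceOrder
end

theorem theorem1 {H : Type*} [NormedAddCommGroup H] [InnerProductSpace ℂ H] [CompleteSpace H]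
    (A B : H →L[ℂ] H) (hA : IsSelfAdjoint A) (hB : IsSelfAdjoint B) :
    List.TFAE [
      ∀ x : H, ‖x‖ = 1 →
        VarianceOrder.variance (VarianceOrder.pureState x) A ≤
          VarianceOrder.variance (VarianceOrder.pureState x) B,
      ∀ ρ : H →L[ℂ] H, VarianceOrder.IsState ρ →
        VarianceOrder.variance ρ A ≤ VarianceOrder.variance ρ B,
      ∃ (f : spectrum ℝ B → ℝ) (hf : LipschitzWith 1 f), A = cfcHom hB ⟨f, hf.continuous⟩] := by
  tfae_have 2 → 1 := fun h x hx => h _ (VarianceOrder.isState_pureState hx)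
  tfae_have 3 → 2 := by
    rintro ⟨f, hf, rfl⟩ ρ hρ
    exact hρ.variance_cfcHom_le hB hf
  tfae_have 1 → 3 := fun h =>
    VarianceOrder.exists_lipschitz_eq_cfcHom hB (VarianceOrder.exists_norm_sub_smul_le hA hB h)
  tfae_finish
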